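/- Let $r<0$, $T>0$, $x_0\in\mathbb R$, let $a,b,f,g:\mathbb R\to\mathbb R$ be continuously differentiable and $\Psi:\mathbb R\to\mathbb R$ differentiable, and let $U\subseteq\mathbb R$ be a closed interval, possibly unbounded (for example $U=\mathbb R$, no constraint, or $U=[0,1]$). Consider $$\max\;\Psi(x(T))+\int_0^T \bigl(a(x)+b(x)u+ru^2\bigr)\,dt\quad\text{subject to}\quad \dot x=f(x)+u\,g(x),\quad x(0)=x_0,\quad u(t)\in U,$$ over square-integrable controls $u$ on $[0,T]$ and the corresponding absolutely continuous states $x$ on $[0,T]$. Let $H(x,u,\lambda)=a(x)+b(x)u+ru^2+\lambda(f(x)+u\,g(x))$ and let $u^*(x,\lambda)=\frac{-b(x)-g(x)\lambda}{2r}$ be its maximizer over $u\in\mathbb R$. (1) If $f=A\,g$ on $\mathbb R$ for some $A\in\mathbb R$, then $g f'-f g'=0$ on $\mathbb R$. On every open interval $I$ on which $g$ has no zero (for instance $I=\mathbb R$ if $g$ never vanishes), $g f'-f g'=0$ holds on $I$ if and only if there is $A\in\mathbb R$ with $f=A\,g$ on $I$. (2) Suppose that $g(y)f'(y)-f(y)g'(y)=0$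 for all $y\in\mathbb R$, and let $(x,u)$ be an optimal pair. Then, after changing $u$ on a null set, $u$ is continuous on $[0,T]$ with values in $U$, $\dot x=f(x)+u\,g(x)$ holds at every $t\in[0,T]$, and there is a costate $\lambda$ with $\dot\lambda=-\partial H/\partial x\,(x,u,\lambda)$ on $[0,T]$ and $\lambda(T)=\Psi'(x(T))$, such that $u(t)$ maximizes $H(x(t),\cdot,\lambda(t))$ over $U$ for every $t\in[0,T]$. Moreover (derivatives at $0$ and $T$ being one-sided): (a) at every $t_0\in[0,T]$ such that $u^*(x(t),\lambda(t))\in U$ for all $t\in[0,T]$ near $t_0$, one has $u(t_0)=u^*(x(t_0),\lambda(t_0))$, and $u$ is differentiable at $t_0$ with $$\dot u=\frac{g(x)a'(x)-f(x)b'(x)}{2r},$$ which depends on the state $x$ only; (b) if $\frac{-b(x(T))-g(x(T))\Psi'(x(T))}{2r}\in U$, then $u(T)=\frac{-b(x(T))-g(x(T))\Psi'(x(T))}{2r}$; (c) if $u^*(x(t),\lambda(t))\in U$ for all $t\in[0,T]$ (which always holds when $U=\mathbb R$), then $(x,u)$ solves on $[0,T]$ the two-point boundary value problem in the state and the control only $$\dot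 x=f(x)+u\,g(x),\qquad \dot u=\frac{g(x)a'(x)-f(x)b'(x)}{2r},\qquad x(0)=x_0,\qquad u(T)=\frac{-b(x(T))-g(x(T))\Psi'(x(T))}{2r}.$$ -/

import Mathlib

open MeasureTheory Set Filter Topology

/-- Data of the scalar control-affine problem: maximise
`Ψ (x T) + ∫₀ᵀ (a x + b x * u + r * u ^ 2) dt` subject to `x' = f x + u * g x`, `x 0 = x₀`,
with control values in `U` (the unconstrained problem is `U = Set.univ`). -/
structure ControlProblem where
  a : ℝ → ℝ
  b : ℝ → ℝ
  f : ℝ → ℝ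
  g : ℝ → ℝ
  Ψ : ℝ → ℝ
  r : ℝ
  T : ℝ
  x₀ : ℝ
  U : Set ℝ

namespace ControlProblem

/-- `u` is a square-integrable control on `[0, T]` with values in `U`, and `x` is a (Carathéodory)
solution on `[0, T]` of `x' = f x + u * g x`, `x 0 = x₀`, in integral form. -/
def IsAdmissible (P : ControlProblem) (x u : ℝ → ℝ) : Prop :=
  MemLp u 2 (volume.restrict (Icc 0 P.T)) ∧
  (∀ᵐ t ∂(volume.restrict (Icc 0 P.T)), u t ∈ P.U) ∧
  ContinuousOn x (Icc 0 P.T) ∧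
  ∀ t ∈ Icc 0 P.T, x t = P.x₀ + ∫ s in (0 : ℝ)..t, (P.f (x s) + u s * P.g (x s))

/-- The objective functional. -/
noncomputable def payoff (P : ControlProblem) (x u : ℝ → ℝ) : ℝ :=
  P.Ψ (x P.T) + ∫ t in (0 : ℝ)..P.T, (P.a (x t) + P.b (x t) * u t + P.r * u t ^ 2)

/-- `(x, u)` maximises the objective among all admissible pairs. -/
def IsOptimal (P : ControlProblem) (x u : ℝ → ℝ) : Prop :=
  P.IsAdmissible x u ∧ ∀ y v : ℝ → ℝ, P.IsAdmissible y v → P.payoff y v ≤ P.payoff x u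

/-- The Hamiltonian, with state `y`, control `v` and costate `l`. -/
def hamiltonian (P : ControlProblem) (y v l : ℝ) : ℝ :=
  P.a y + P.b y * v + P.r * v ^ 2 + l * (P.f y + v * P.g y)

/-- The maximiser over `v ∈ ℝ` of the Hamiltonian (when `r < 0`). -/
noncomputable def uStar (P : ControlProblem) (y l : ℝ) : ℝ :=
  (-P.b y - P.g y * l) / (2 * P.r)

/-- `p` is the costate along `(x, u)`: `p' = -∂H/∂x` on `[0, T]` and `p T = Ψ' (x T)`. -/
def IsCostate (P : ControlProblem) (x u p : ℝ → ℝ) : Prop :=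
  (∀ t ∈ Icc 0 P.T,
    HasDerivWithinAt p (-deriv (fun y => P.hamiltonian y (u t) (p t)) (x t)) (Icc 0 P.T) t) ∧
  p P.T = deriv P.Ψ (x P.T)

/-- The right-hand side `(g a' - f b') / (2 r)` of the control equation. -/
noncomputable def uDot (P : ControlProblem) (y : ℝ) : ℝ :=
  (P.g y * deriv P.a y - P.f y * deriv P.b y) / (2 * P.r)

/-- The terminal value `(-b - g Ψ') / (2 r)`. -/
noncomputable def uTerminal (P : ControlProblem) (y : ℝ) : ℝ :=
  (-P.b y - P.g y * deriv P.Ψ y) / (2 * P.r)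

/-- `(x, u)` solves, on `[0, T]`, the two-point boundary value problem in state and control. -/
def SolvesBVP (P : ControlProblem) (x u : ℝ → ℝ) : Prop :=
  (∀ t ∈ Icc 0 P.T, HasDerivWithinAt x (P.f (x t) + u t * P.g (x t)) (Icc 0 P.T) t) ∧
  (∀ t ∈ Icc 0 P.T, HasDerivWithinAt u (P.uDot (x t)) (Icc 0 P.T) t) ∧
  x 0 = P.x₀ ∧ u P.T = P.uTerminal (x P.T)

end ControlProblem

/-- `y` is on `[0, T]` the primitive of the integrable function `φ`. -/
def IsPrimitiveOn (y φ : ℝ → ℝ) (T : ℝ) : Prop :=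
  IntervalIntegrable φ volume 0 T ∧ ∀ t ∈ Icc 0 T, y t = y 0 + ∫ s in (0 : ℝ)..t, φ s

namespace IsPrimitiveOn

variable {y z φ ψ : ℝ → ℝ} {T : ℝ}

theorem absolutelyContinuousOnInterval (h : IsPrimitiveOn y φ T) (hT : 0 ≤ T) :
    AbsolutelyContinuousOnInterval y 0 T := by
  have hI := (h.1.absolutelyContinuousOnInterval_intervalIntegral (c := 0) (by simp)).fun_add
    ((LipschitzWith.const (y 0)).lipschitzOnWith.absolutelyContinuousOnInterval
      (a := 0) (b := T))
  rw [absolutelyContinuousOnInterval_iff] at hI ⊢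
  intro ε hε
  obtain ⟨δ, hδ, H⟩ := hI ε hε
  refine ⟨δ, hδ, fun E hE hlt => ?_⟩
  convert H E hE hlt using 2 with i hi
  obtain ⟨h1, h2⟩ := hE.1 i hi
  rw [uIcc_of_le hT] at h1 h2
  rw [h.2 _ h1, h.2 _ h2, add_comm (y 0), add_comm (y 0)]

theorem continuousOn (h : IsPrimitiveOn y φ T) (hT : 0 ≤ T) : ContinuousOn y (Icc 0 T) := by
  simpa [uIcc_of_le hT] using (h.absolutelyContinuousOnInterval hT).continuousOn

theorem ae_hasDerivAt (h : IsPrimitiveOn y φ T) (hT : 0 ≤ T) :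
    ∀ᵐ t, t ∈ Icc 0 T → HasDerivAt y (φ t) t := by
  have h₁ : ∀ᵐ t : ℝ, t ≠ 0 := by simp [ae_iff, measure_singleton]
  have h₂ : ∀ᵐ t : ℝ, t ≠ T := by simp [ae_iff, measure_singleton]
  filter_upwards [h.1.ae_hasDerivAt_integral, h₁, h₂] with t ht h0 h1 hmem
  have hd := (ht (by rwa [uIcc_of_le hT]) 0 (by simp)).const_add (y 0)
  refine hd.congr_of_eventuallyEq ?_
  filter_upwards [Icc_mem_nhds (lt_of_le_of_ne hmem.1 (Ne.symm h0))
    (lt_of_le_of_ne hmem.2 h1)] with s hs using h.2 s hs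

theorem of_ae_hasDerivAt (hT : 0 ≤ T) (hac : AbsolutelyContinuousOnInterval y 0 T)
    (hd : ∀ᵐ t, t ∈ Icc 0 T → HasDerivAt y (φ t) t) : IsPrimitiveOn y φ T := by
  have hsub : ∀ t ∈ Icc 0 T, uIoc 0 t ⊆ Icc 0 T := fun t ht => by
    rw [uIoc_of_le ht.1]; exact fun s hs => ⟨hs.1.le, hs.2.trans ht.2⟩
  constructor
  · refine hac.intervalIntegrable_deriv.congr_ae ?_
    rw [EventuallyEq, ae_restrict_iff' measurableSet_uIoc]
    filter_upwards [hd] with t ht hm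
    exact (ht (hsub T ⟨hT, le_rfl⟩ hm)).deriv
  · intro t ht
    have hsubset : uIcc 0 t ⊆ uIcc 0 T := by
      rw [uIcc_of_le hT, uIcc_of_le ht.1]; exact Icc_subset_Icc_right ht.2
    have hI := (hac.mono hsubset).integral_deriv_eq_sub
    have hc : ∫ s in (0 : ℝ)..t, deriv y s = ∫ s in (0 : ℝ)..t, φ s := by
      apply intervalIntegral.integral_congr_ae
      filter_upwards [hd] with s hs hm
      exact (hs (hsub t ht hm)).deriv
    rw [← hc, hI]; ring

theorem congr_ae (h : IsPrimitiveOn y φ T) (hT : 0 ≤ T)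
    (hφ : φ =ᵐ[volume.restrict (Icc 0 T)] ψ) : IsPrimitiveOn y ψ T := by
  refine of_ae_hasDerivAt hT (h.absolutelyContinuousOnInterval hT) ?_
  rw [EventuallyEq, ae_restrict_iff' measurableSet_Icc] at hφ
  filter_upwards [h.ae_hasDerivAt hT, hφ] with t h1 h2 hm
  rw [← h2 hm]; exact h1 hm

theorem congr (h : IsPrimitiveOn y φ T) (hT : 0 ≤ T) (hφ : EqOn φ ψ (Icc 0 T)) :
    IsPrimitiveOn y ψ T :=
  h.congr_ae hT ((ae_restrict_iff' measurableSet_Icc).2 (Eventually.of_forall hφ))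

theorem mul (hy : IsPrimitiveOn y φ T) (hz : IsPrimitiveOn z ψ T) (hT : 0 ≤ T) :
    IsPrimitiveOn (fun t => y t * z t) (fun t => φ t * z t + y t * ψ t) T := by
  refine of_ae_hasDerivAt hT ((hy.absolutelyContinuousOnInterval hT).fun_mul
    (hz.absolutelyContinuousOnInterval hT)) ?_
  filter_upwards [hy.ae_hasDerivAt hT, hz.ae_hasDerivAt hT] with t h1 h2 hm
  exact (h1 hm).mul (h2 hm)

theorem add_const_mul (hy : IsPrimitiveOn y φ T) (hz : IsPrimitiveOn z ψ T) (hT : 0 ≤ T) (c : ℝ) :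
    IsPrimitiveOn (fun t => y t + c * z t) (fun t => φ t + c * ψ t) T := by
  refine of_ae_hasDerivAt hT ((hy.absolutelyContinuousOnInterval hT).fun_add
    ((hz.absolutelyContinuousOnInterval hT).const_mul c)) ?_
  filter_upwards [hy.ae_hasDerivAt hT, hz.ae_hasDerivAt hT] with t h1 h2 hm
  exact (h1 hm).add ((h2 hm).const_mul c)

theorem comp (hy : IsPrimitiveOn y φ T) (hT : 0 ≤ T) {F F' : ℝ → ℝ}
    (hF : ∀ v, HasDerivAt F (F' v) v) (hF' : Continuous F') :
    IsPrimitiveOn (fun t => F (y t)) (fun t => F' (y t) * φ t) T := by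
  have hF1 : ContDiff ℝ 1 F := by
    rw [contDiff_one_iff_deriv]
    refine ⟨fun v => (hF v).differentiableAt, ?_⟩
    rwa [show deriv F = F' from funext fun v => (hF v).deriv]
  have hyac := hy.absolutelyContinuousOnInterval hT
  obtain ⟨C, hC⟩ := hyac.exists_bound
  obtain ⟨K, hK⟩ := (hF1.contDiffOn (s := Icc (-C) C)).exists_lipschitzOnWith (by decide)
    (convex_Icc _ _) isCompact_Icc
  refine of_ae_hasDerivAt hT ?_ ?_
  · rw [absolutelyContinuousOnInterval_iff] at hyac ⊢
    intro ε hε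
    obtain ⟨δ, hδ, H⟩ := hyac (ε / (K + 1)) (by positivity)
    refine ⟨δ, hδ, fun E hE hlt => ?_⟩
    calc ∑ i ∈ Finset.range E.1, dist (F (y (E.2 i).1)) (F (y (E.2 i).2))
        ≤ ∑ i ∈ Finset.range E.1, (K + 1) * dist (y (E.2 i).1) (y (E.2 i).2) := by
          refine Finset.sum_le_sum fun i hi => ?_
          obtain ⟨h1, h2⟩ := hE.1 i hi
          refine (hK.dist_le_mul _ (abs_le.1 (hC _ h1)) _ (abs_le.1 (hC _ h2))).trans ?_
          gcongr; linarith
      _ = (K + 1) * ∑ i ∈ Finset.range E.1, dist (y (E.2 i).1) (y (E.2 i).2) := by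
          rw [Finset.mul_sum]
      _ < (K + 1) * (ε / (K + 1)) := by
          have := H E hE hlt
          gcongr
      _ = ε := by field_simp
  · filter_upwards [hy.ae_hasDerivAt hT] with t h1 hm
    exact (hF (y t)).comp t (h1 hm)

theorem hasDerivWithinAt (h : IsPrimitiveOn y φ T) (hT : 0 ≤ T) (hφ : ContinuousOn φ (Icc 0 T))
    {t : ℝ} (ht : t ∈ Icc 0 T) : HasDerivWithinAt y (φ t) (Icc 0 T) t := by
  have : Fact (t ∈ Icc 0 T) := ⟨ht⟩
  have hint : IntervalIntegrable φ volume 0 t :=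
    h.1.mono_set (by rw [uIcc_of_le hT, uIcc_of_le ht.1]; exact Icc_subset_Icc_right ht.2)
  have := intervalIntegral.integral_hasDerivWithinAt_right hint (s := Icc 0 T) (t := Icc 0 T)
    (hφ.stronglyMeasurableAtFilter_nhdsWithin measurableSet_Icc t) (hφ t ht)
  exact (this.const_add (y 0)).congr (fun s hs => h.2 s hs) (h.2 t ht)

theorem of_integral (hφ : IntervalIntegrable φ volume 0 T) (c : ℝ) :
    IsPrimitiveOn (fun t => c + ∫ s in (0 : ℝ)..t, φ s) φ T :=
  ⟨hφ, fun t _ => by simp⟩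

/-- A solution of a scalar linear equation with integrable coefficient that vanishes somewhere
vanishes identically. -/
theorem eq_zero_of_linear {κ : ℝ → ℝ} (hκ : IntervalIntegrable κ volume 0 T) (hT : 0 ≤ T)
    (hz : IsPrimitiveOn z (fun t => κ t * z t) T) {t₁ : ℝ} (ht₁ : t₁ ∈ Icc 0 T) (h0 : z t₁ = 0) :
    ∀ t ∈ Icc 0 T, z t = 0 := by
  have hE := (of_integral hκ.neg 0).comp hT Real.hasDerivAt_exp Real.continuous_exp
  set K : ℝ → ℝ := fun t => 0 + ∫ s in (0 : ℝ)..t, -κ s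
  have hp := (hz.mul hE hT).congr hT (ψ := fun _ => 0) (fun t _ => by simp; ring)
  have hconst : ∀ t ∈ Icc 0 T, z t * Real.exp (K t) = z 0 * Real.exp (K 0) := fun t ht => by
    have := hp.2 t ht
    rwa [intervalIntegral.integral_zero, add_zero] at this
  have hzero : z 0 * Real.exp (K 0) = 0 := by rw [← hconst t₁ ht₁, h0, zero_mul]
  intro t ht
  have := (hconst t ht).trans hzero
  simpa [(Real.exp_pos _).ne'] using this

end IsPrimitiveOn

/-- The metric projection onto a nonempty closed convex set of reals is continuous. -/
theorem exists_continuous_projection {U : Set ℝ} (hne : U.Nonempty) (hc : IsClosed U)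
    (hconv : Convex ℝ U) :
    ∃ π : ℝ → ℝ, Continuous π ∧ ∀ y, π y ∈ U ∧ ∀ v ∈ U, (y - π y) * (v - π y) ≤ 0 := by
  choose π hπU hπ using exists_norm_eq_iInf_of_complete_convex hne hc.isComplete hconv
  have key : ∀ y, ∀ v ∈ U, (y - π y) * (v - π y) ≤ 0 := fun y v hv => by
    have := (norm_eq_iInf_iff_real_inner_le_zero hconv (hπU y)).1 (hπ y) v hv
    simpa [mul_comm] using this
  refine ⟨π, ?_, fun y => ⟨hπU y, key y⟩⟩
  have hL : LipschitzWith 1 π := by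
    refine LipschitzWith.of_dist_le_mul fun y z => ?_
    have h1 := key y _ (hπU z)
    have h2 := key z _ (hπU y)
    rw [Real.dist_eq, Real.dist_eq, NNReal.coe_one, one_mul]
    have h3 : (π y - π z) ^ 2 ≤ (y - z) * (π y - π z) := by nlinarith
    have h4 : |π y - π z| * |π y - π z| ≤ |y - z| * |π y - π z| := by
      rw [← abs_mul, ← abs_mul, ← sq, abs_of_nonneg (sq_nonneg _)]
      exact h3.trans (le_abs_self _)
    by_contra hlt
    push Not at hlt
    nlinarith [abs_nonneg (y - z), abs_nonneg (π y - π z)]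
  exact hL.continuous

/-- A control satisfying the first-order inequality in the direction of the pointwise maximiser
`w` of the strictly concave function `v ↦ c v + r v ^ 2` coincides with `w`. -/
theorem ae_eq_of_integral_variation_nonpos {μ : Measure ℝ} {c u w : ℝ → ℝ} {r : ℝ} (hr : r < 0)
    (hint : Integrable (fun t => (c t + 2 * r * u t) * (w t - u t)) μ)
    (hsq : Integrable (fun t => (w t - u t) ^ 2) μ)
    (hmax : ∀ᵐ t ∂μ, (c t + 2 * r * w t) * (u t - w t) ≤ 0)
    (hvar : ∫ t, ((c t + 2 * r * u t) * (w t - u t) + r * (w t - u t) ^ 2) ∂μ ≤ 0) :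
    w =ᵐ[μ] u := by
  have hge : ∀ᵐ t ∂μ, -r * (w t - u t) ^ 2 ≤
      (c t + 2 * r * u t) * (w t - u t) + r * (w t - u t) ^ 2 := by
    filter_upwards [hmax] with t ht
    nlinarith
  have hle := (integral_mono_ae (hsq.const_mul (-r)) (hint.add (hsq.const_mul r)) hge).trans hvar
  have hnn : 0 ≤ fun t => -r * (w t - u t) ^ 2 := fun t =>
    mul_nonneg (neg_nonneg.2 hr.le) (sq_nonneg _)
  have h0 := (integral_eq_zero_iff_of_nonneg hnn (hsq.const_mul (-r))).1
    (le_antisymm hle (integral_nonneg hnn))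
  filter_upwards [h0] with t ht
  have : w t - u t = 0 := by simpa [hr.ne] using ht
  linarith

/-- The flow of a positive bounded continuous scalar vector field, in terms of a global time
coordinate `G`. -/
theorem exists_flow_coordinate {h : ℝ → ℝ} (hc : Continuous h) (hpos : ∀ y, 0 < h y) {M : ℝ}
    (hM : ∀ y, h y ≤ M) :
    ∃ G Φ : ℝ → ℝ, (∀ y, HasDerivAt G (h y)⁻¹ y) ∧ (∀ s, HasDerivAt Φ (h (Φ s)) s) ∧
      ∀ y, Φ (G y) = y := by
  have hMpos : 0 < M := (hpos 0).trans_le (hM 0)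
  have hci : Continuous fun y => (h y)⁻¹ := hc.inv₀ fun y => (hpos y).ne'
  set G : ℝ → ℝ := fun y => ∫ s in (0 : ℝ)..y, (h s)⁻¹
  have hG : ∀ y, HasDerivAt G (h y)⁻¹ y := fun y => hci.integral_hasStrictDerivAt 0 y |>.hasDerivAt
  have hGc : Continuous G := continuous_iff_continuousAt.2 fun y => (hG y).continuousAt
  have hmono : StrictMono G := strictMono_of_hasDerivAt_pos hG fun y => inv_pos.2 (hpos y)
  have hmono' : Monotone fun y => G y - M⁻¹ * y := by
    have hd : ∀ y, HasDerivAt (fun y => G y - M⁻¹ * y) ((h y)⁻¹ - M⁻¹ * 1) y := fun y =>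
      (hG y).sub ((hasDerivAt_id y).const_mul _)
    refine monotone_of_deriv_nonneg (fun y => (hd y).differentiableAt) fun y => ?_
    rw [(hd y).deriv, mul_one, sub_nonneg]
    exact inv_anti₀ (hpos y) (hM y)
  have hG0 : G 0 = 0 := by simp [G]
  have hsurj : Function.Surjective G := by
    refine hGc.surjective ?_ ?_
    · refine tendsto_atTop_mono' _ ?_ (tendsto_id.const_mul_atTop (inv_pos.2 hMpos))
      filter_upwards [eventually_ge_atTop 0] with y hy
      have := hmono' hy
      simp only [hG0, mul_zero, sub_zero, id] at this ⊢
      linarith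
    · refine tendsto_atBot_mono' _ ?_ (tendsto_id.const_mul_atBot (inv_pos.2 hMpos))
      filter_upwards [eventually_le_atBot 0] with y hy
      have := hmono' hy
      simp only [hG0, mul_zero, sub_zero, id] at this ⊢
      linarith
  set e := hmono.orderIsoOfSurjective G hsurj
  refine ⟨G, e.symm, hG, fun s => ?_, fun y => e.symm_apply_apply y⟩
  have := HasDerivAt.of_local_left_inverse (g := e.symm) (a := s)
    e.symm.continuous.continuousAt (hG (e.symm s)) (inv_pos.2 (hpos _)).ne'
    (Eventually.of_forall fun y => e.apply_symm_apply y)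
  simpa using this

/-- Two functions with vanishing Wronskian and no common zero on an open interval are constant
multiples of one positive function. -/
theorem exists_common_factor {f g : ℝ → ℝ} (hf : Differentiable ℝ f) (hg : Differentiable ℝ g)
    {W : Set ℝ} (hW : IsOpen W) (hW' : IsPreconnected W)
    (hfg : ∀ y ∈ W, g y * deriv f y - f y * deriv g y = 0)
    (hne : ∀ y ∈ W, f y ^ 2 + g y ^ 2 ≠ 0) :
    ∃ α β : ℝ, ∀ y ∈ W, 0 < α * f y + β * g y ∧ f y = α * (α * f y + β * g y) ∧
      g y = β * (α * f y + β * g y) := by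
  set n : ℝ → ℝ := fun y => Real.sqrt (f y ^ 2 + g y ^ 2)
  have hpos : ∀ y ∈ W, 0 < f y ^ 2 + g y ^ 2 := fun y hy =>
    lt_of_le_of_ne (by positivity) (hne y hy).symm
  have hn : ∀ y ∈ W, 0 < n y := fun y hy => Real.sqrt_pos.2 (hpos y hy)
  have hn2 : ∀ y ∈ W, n y ^ 2 = f y ^ 2 + g y ^ 2 := fun y hy => Real.sq_sqrt (hpos y hy).le
  have hnd : ∀ y ∈ W, HasDerivAt n ((f y * deriv f y + g y * deriv g y) / n y) y := fun y hy => by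
    have h1 := ((hf y).hasDerivAt.pow 2).add ((hg y).hasDerivAt.pow 2)
    have h2 := h1.sqrt (hne y hy)
    refine h2.congr_deriv ?_
    have := (hn y hy).ne'
    change _ / (2 * n y) = _
    field_simp
    push_cast
    ring
  have hquot : ∀ k : ℝ → ℝ, Differentiable ℝ k →
      (∀ y ∈ W, deriv k y * n y ^ 2 = k y * (f y * deriv f y + g y * deriv g y)) →
      ∃ γ, ∀ y ∈ W, k y = γ * n y := fun k hk hk' => by
    have hd : ∀ y ∈ W, HasDerivAt (fun y => k y / n y) 0 y := fun y hy => by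
      refine ((hk y).hasDerivAt.div (hnd y hy) (hn y hy).ne').congr_deriv ?_
      have h1 := (hn y hy).ne'
      have h2 := hk' y hy
      field_simp
      linarith
    obtain ⟨γ, hγ⟩ := hW.exists_is_const_of_deriv_eq_zero hW'
      (fun y hy => (hd y hy).differentiableAt.differentiableWithinAt)
      (fun y hy => (hd y hy).deriv)
    refine ⟨γ, fun y hy => ?_⟩
    rw [← hγ y hy, div_mul_cancel₀ _ (hn y hy).ne']
  obtain ⟨α, hα⟩ := hquot f hf fun y hy => by
    rw [hn2 y hy]; linear_combination (g y) * hfg y hy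
  obtain ⟨β, hβ⟩ := hquot g hg fun y hy => by
    rw [hn2 y hy]; linear_combination (-f y) * hfg y hy
  refine ⟨α, β, fun y hy => ?_⟩
  have h1 : α ^ 2 + β ^ 2 = 1 := by
    have h2 := hn2 y hy
    rw [hα y hy, hβ y hy] at h2
    have h3 : (α ^ 2 + β ^ 2 - 1) * n y ^ 2 = 0 := by linarith
    have := (mul_eq_zero.1 h3).resolve_right (pow_pos (hn y hy) 2).ne'
    linarith
  have h2 : α * f y + β * g y = n y := by
    rw [hα y hy, hβ y hy]; linear_combination n y * h1
  rw [h2]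
  exact ⟨hn y hy, hα y hy, hβ y hy⟩

theorem exists_Icc_subset_of_isOpen {Z : Set ℝ} (hZ : IsOpen Z) {A B : ℝ} (hAB : A ≤ B)
    (h : Icc A B ⊆ Z) : ∃ δ > 0, Icc (A - δ) (B + δ) ⊆ Z := by
  obtain ⟨δ, hδ, H⟩ := isCompact_Icc.exists_cthickening_subset_open hZ h
  refine ⟨δ, hδ, fun y hy => H ?_⟩
  have hmem : max A (min B y) ∈ Icc A B := ⟨le_max_left _ _, max_le hAB (min_le_left _ _)⟩
  refine Metric.mem_cthickening_of_dist_le y _ δ _ hmem ?_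
  rw [Real.dist_eq, abs_le]
  obtain ⟨h1, h2⟩ := hy
  grind

/-- Under the Wronskian condition, a compact set of states without common zero of `f` and `g` has
a neighbourhood on which `f` and `g` are multiples of one positive field, extended to a bounded
field on the line. -/
theorem exists_global_common_factor {f g : ℝ → ℝ} (hf : ContDiff ℝ 1 f) (hg : ContDiff ℝ 1 g)
    (hfg : ∀ y, g y * deriv f y - f y * deriv g y = 0) {A B : ℝ} (hAB : A ≤ B)
    (hne : ∀ y ∈ Icc A B, f y ^ 2 + g y ^ 2 ≠ 0) :
    ∃ (α β δ M : ℝ) (h : ℝ → ℝ), 0 < δ ∧ Continuous h ∧ (∀ y, 0 < h y) ∧ (∀ y, h y ≤ M) ∧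
      (∀ y ∈ Icc (A - δ) (B + δ), h y = α * f y + β * g y ∧ f y = α * h y ∧ g y = β * h y) := by
  have hZ : IsOpen {y | f y ^ 2 + g y ^ 2 ≠ 0} :=
    isOpen_ne_fun ((hf.continuous.pow 2).add (hg.continuous.pow 2)) continuous_const
  obtain ⟨δ, hδ, hsub⟩ := exists_Icc_subset_of_isOpen hZ hAB hne
  obtain ⟨α, β, H⟩ := exists_common_factor (hf.differentiable one_ne_zero)
    (hg.differentiable one_ne_zero) isOpen_Ioo isPreconnected_Ioo
    (W := Ioo (A - δ) (B + δ)) (fun y _ => hfg y) (fun y hy => hsub (Ioo_subset_Icc_self hy))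
  have hle : A - δ / 2 ≤ B + δ / 2 := by linarith
  set h₀ : ℝ → ℝ := fun y => α * f y + β * g y
  have hc₀ : Continuous h₀ := (hf.continuous.const_mul α).add (hg.continuous.const_mul β)
  obtain ⟨M, hM⟩ := (isCompact_Icc (a := A - δ / 2) (b := B + δ / 2)).exists_bound_of_continuousOn
    hc₀.continuousOn
  have hIoo : ∀ y ∈ Icc (A - δ / 2) (B + δ / 2), y ∈ Ioo (A - δ) (B + δ) := fun y hy =>
    ⟨by linarith [hy.1], by linarith [hy.2]⟩
  have hproj : ∀ y, (projIcc _ _ hle y : ℝ) ∈ Icc (A - δ / 2) (B + δ / 2) := fun y =>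
    (projIcc _ _ hle y).2
  refine ⟨α, β, δ / 2, M, fun y => h₀ (projIcc _ _ hle y), by positivity,
    hc₀.comp (continuous_subtype_val.comp continuous_projIcc),
    fun y => (H _ (hIoo _ (hproj y))).1,
    fun y => (le_abs_self _).trans (hM _ (hproj y)), fun y hy => ?_⟩
  have := (H y (hIoo y hy)).2
  simp only [projIcc_of_mem hle hy]
  exact ⟨rfl, this⟩

/-- A trajectory through a common zero of `f` and `g` is constant. -/
theorem eq_const_of_common_zero {f g : ℝ → ℝ} (hf : ContDiff ℝ 1 f) (hg : ContDiff ℝ 1 g)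
    {x u : ℝ → ℝ} {T : ℝ} (hT : 0 ≤ T) (hu : IntervalIntegrable u volume 0 T)
    (hx : IsPrimitiveOn x (fun s => f (x s) + u s * g (x s)) T) {t₁ : ℝ} (ht₁ : t₁ ∈ Icc 0 T)
    (hf0 : f (x t₁) = 0) (hg0 : g (x t₁) = 0) : ∀ t ∈ Icc 0 T, x t = x t₁ := by
  set c := x t₁
  have hxc : ContinuousOn x (uIcc 0 T) := by rw [uIcc_of_le hT]; exact hx.continuousOn hT
  have hds : ∀ k : ℝ → ℝ, ContDiff ℝ 1 k → ContinuousOn (fun t => dslope k c (x t)) (uIcc 0 T) :=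
    fun k hk => by
      have : Continuous (dslope k c) := by
        rw [← continuousOn_univ, continuousOn_dslope univ_mem]
        exact ⟨hk.continuous.continuousOn, hk.differentiable one_ne_zero c⟩
      exact this.comp_continuousOn hxc
  have hfac : ∀ k : ℝ → ℝ, k c = 0 → ∀ y, k y = dslope k c y * (y - c) := fun k hk y => by
    have := sub_smul_dslope k c y
    rw [hk, sub_zero, smul_eq_mul] at this
    rw [← this, mul_comm]
  have hκ : IntervalIntegrable (fun t => dslope f c (x t) + u t * dslope g c (x t)) volume 0 T :=
    (hds f hf).intervalIntegrable.add (hu.mul_continuousOn (hds g hg))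
  have hz : IsPrimitiveOn (fun t => x t - c)
      (fun t => (dslope f c (x t) + u t * dslope g c (x t)) * (x t - c)) T := by
    refine IsPrimitiveOn.congr ⟨hx.1, fun t ht => ?_⟩ hT fun t _ => ?_
    · change x t - c = x 0 - c + _
      rw [hx.2 t ht]; ring
    · rw [hfac f hf0 (x t), hfac g hg0 (x t)]; ring
  intro t ht
  have := IsPrimitiveOn.eq_zero_of_linear hκ hT hz ht₁ (by simp [c]) t ht
  linarith

/-- Differentiation of a running payoff, quadratic in the control, along a variation. -/
theorem hasDerivAt_integral_quadratic_payoff {A A' B B' : ℝ → ℝ} {r T : ℝ}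
    (hA : ∀ s, HasDerivAt A (A' s) s) (hA' : Continuous A')
    (hB : ∀ s, HasDerivAt B (B' s) s) (hB' : Continuous B')
    {θ η u v : ℝ → ℝ} (hθ : ContinuousOn θ (Icc 0 T)) (hη : ContinuousOn η (Icc 0 T))
    (hu : MemLp u 2 (volume.restrict (Icc 0 T))) (hv : MemLp v 2 (volume.restrict (Icc 0 T))) :
    HasDerivAt
      (fun ε : ℝ => ∫ t in Icc 0 T, (A (θ t + ε * η t) + B (θ t + ε * η t) * (u t + ε * v t)
        + r * (u t + ε * v t) ^ 2))
      (∫ t in Icc 0 T, (A' (θ t) * η t + (B' (θ t) * η t * u t + B (θ t) * v t)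
        + 2 * r * u t * v t)) 0 := by
  set μ := volume.restrict (Icc 0 T)
  have hAc : Continuous A := continuous_iff_continuousAt.2 fun s => (hA s).continuousAt
  have hBc : Continuous B := continuous_iff_continuousAt.2 fun s => (hB s).continuousAt
  obtain ⟨R₁, hR₁⟩ := isCompact_Icc.exists_bound_of_continuousOn hθ
  obtain ⟨N, hN⟩ := isCompact_Icc.exists_bound_of_continuousOn hη
  obtain ⟨M₁, hM₁⟩ := (isCompact_Icc (a := -(R₁ + N)) (b := R₁ + N)).exists_bound_of_continuousOn
    hA'.continuousOn
  obtain ⟨M₂, hM₂⟩ := (isCompact_Icc (a := -(R₁ + N)) (b := R₁ + N)).exists_bound_of_continuousOn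
    hB'.continuousOn
  obtain ⟨M₃, hM₃⟩ := (isCompact_Icc (a := -(R₁ + N)) (b := R₁ + N)).exists_bound_of_continuousOn
    hBc.continuousOn
  have hmem : ∀ t ∈ Icc 0 T, ∀ ε ∈ Metric.ball (0 : ℝ) 1,
      θ t + ε * η t ∈ Icc (-(R₁ + N)) (R₁ + N) := fun t ht ε hε => by
    rw [mem_ball_zero_iff] at hε
    refine abs_le.1 ((abs_add_le _ _).trans (add_le_add (hR₁ t ht) ?_))
    rw [abs_mul]
    have h1 := hN t ht
    rw [Real.norm_eq_abs] at h1 hε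
    nlinarith [abs_nonneg ε, abs_nonneg (η t)]
  have hu2 : ∀ ε : ℝ, MemLp (fun t => u t + ε * v t) 2 μ := fun ε => hu.add (hv.const_mul ε)
  have hcm : ∀ {k : ℝ → ℝ}, ContinuousOn k (Icc 0 T) → AEStronglyMeasurable k μ := fun hk =>
    hk.aestronglyMeasurable measurableSet_Icc
  have hpath : ∀ ε : ℝ, ContinuousOn (fun t => θ t + ε * η t) (Icc 0 T) := fun ε =>
    hθ.add (hη.const_smul ε)
  have hmeas : ∀ ε : ℝ, AEStronglyMeasurable (fun t => A (θ t + ε * η t)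
      + B (θ t + ε * η t) * (u t + ε * v t) + r * (u t + ε * v t) ^ 2) μ := fun ε =>
    ((hcm (hAc.comp_continuousOn (hpath ε))).add
      ((hcm (hBc.comp_continuousOn (hpath ε))).mul (hu2 ε).1)).add
      (((hu2 ε).1.pow 2).const_mul r)
  have hui : Integrable u μ := hu.integrable (by norm_num)
  have hvi : Integrable v μ := hv.integrable (by norm_num)
  have huv : Integrable (fun t => |u t| * |v t|) μ := hu.abs.integrable_mul hv.abs
  have hvv : Integrable (fun t => |v t| * |v t|) μ := hv.abs.integrable_mul hv.abs
  have main := hasDerivAt_integral_of_dominated_loc_of_deriv_le (μ := μ) (x₀ := (0 : ℝ))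
    (s := Metric.ball 0 1)
    (F := fun ε t => A (θ t + ε * η t) + B (θ t + ε * η t) * (u t + ε * v t)
        + r * (u t + ε * v t) ^ 2)
    (F' := fun ε t => A' (θ t + ε * η t) * η t + (B' (θ t + ε * η t) * η t * (u t + ε * v t)
        + B (θ t + ε * η t) * v t) + 2 * r * (u t + ε * v t) * v t)
    (bound := fun t => M₁ * N + (M₂ * N * (|u t| + |v t|) + M₃ * |v t|)
        + 2 * |r| * (|u t| * |v t| + |v t| * |v t|))
    (Metric.ball_mem_nhds _ one_pos) (Eventually.of_forall hmeas) ?_ ?_ ?_ ?_ ?_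
  · simpa using main.2
  · simp only [zero_mul, add_zero]
    refine ((hAc.comp_continuousOn hθ).integrableOn_Icc.add ?_).add (hu.integrable_sq.const_mul r)
    obtain ⟨C, hC⟩ := isCompact_Icc.exists_bound_of_continuousOn (hBc.comp_continuousOn hθ)
    exact hui.bdd_mul (hcm (hBc.comp_continuousOn hθ))
      ((ae_restrict_iff' measurableSet_Icc).2 (Eventually.of_forall hC))
  · simp only [zero_mul, add_zero]
    exact (((hcm (hA'.comp_continuousOn hθ)).mul (hcm hη)).add
      ((((hcm (hB'.comp_continuousOn hθ)).mul (hcm hη)).mul hu.1).add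
        ((hcm (hBc.comp_continuousOn hθ)).mul hv.1))).add ((hu.1.const_mul (2 * r)).mul hv.1)
  · refine (ae_restrict_iff' measurableSet_Icc).2 (Eventually.of_forall fun t ht ε hε => ?_)
    have hm := hmem t ht ε hε
    have h1 := hM₁ _ hm
    have h2 := hM₂ _ hm
    have h3 := hM₃ _ hm
    have h4 := hN t ht
    have hε1 : |ε| ≤ 1 := by simpa using (mem_ball_zero_iff.1 hε).le
    have h5 : ‖u t + ε * v t‖ ≤ |u t| + |v t| := by
      refine (norm_add_le _ _).trans (add_le_add le_rfl ?_)
      rw [norm_mul, Real.norm_eq_abs, Real.norm_eq_abs]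
      nlinarith [abs_nonneg (v t)]
    refine (norm_add_le _ _).trans (add_le_add ((norm_add_le _ _).trans (add_le_add ?_
      ((norm_add_le _ _).trans (add_le_add ?_ ?_)))) ?_)
    · rw [norm_mul]; gcongr; exact (norm_nonneg _).trans h1
    · have h6 := (norm_nonneg _).trans h2
      have h7 := (norm_nonneg _).trans h4
      rw [norm_mul, norm_mul]; gcongr
    · rw [norm_mul]; exact mul_le_mul_of_nonneg_right h3 (abs_nonneg _)
    · rw [norm_mul, norm_mul, norm_mul, Real.norm_ofNat, ← add_mul, mul_assoc (2 * _)]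
      exact mul_le_mul_of_nonneg_left (mul_le_mul_of_nonneg_right h5 (abs_nonneg _))
        (by positivity)
  · exact ((integrable_const _).add (((hui.abs.add hvi.abs).const_mul _).add
      (hvi.abs.const_mul _))).add ((huv.add hvv).const_mul _)
  · refine Eventually.of_forall fun t ε _ => ?_
    have hp : HasDerivAt (fun ε : ℝ => θ t + ε * η t) (η t) ε := by
      simpa using ((hasDerivAt_id ε).mul_const (η t)).const_add (θ t)
    have hq : HasDerivAt (fun ε : ℝ => u t + ε * v t) (v t) ε := by
      simpa using ((hasDerivAt_id ε).mul_const (v t)).const_add (u t)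
    refine ((((hA _).comp ε hp).add (((hB _).comp ε hp).mul hq)).add
      ((hq.pow 2).const_mul r)).congr_deriv ?_
    simp only [Function.comp_def]
    push_cast
    ring

/-- A function with a one-sided local maximum at `0` has nonpositive derivative there. -/
theorem HasDerivAt.nonpos_of_eventually_le {j : ℝ → ℝ} {D : ℝ} (hj : HasDerivAt j D 0)
    (h : ∀ᶠ ε in 𝓝[>] (0 : ℝ), j ε ≤ j 0) : D ≤ 0 := by
  have ht := (hasDerivAt_iff_tendsto_slope.1 hj).mono_left
    (nhdsWithin_mono (0 : ℝ) (show Ioi (0 : ℝ) ⊆ {0}ᶜ from fun y hy => ne_of_gt hy))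
  refine le_of_tendsto ht ?_
  filter_upwards [h, self_mem_nhdsWithin] with ε hε hpos
  rw [slope_def_field, sub_zero]
  exact div_nonpos_of_nonpos_of_nonneg (sub_nonpos.2 hε) (le_of_lt hpos)

namespace ControlProblem

variable {P : ControlProblem}

theorem hasDerivAt_of_contDiff {k : ℝ → ℝ} (hk : ContDiff ℝ 1 k) (y : ℝ) :
    HasDerivAt k (deriv k y) y :=
  (hk.differentiable one_ne_zero y).hasDerivAt

theorem deriv_hamiltonian (ha : ContDiff ℝ 1 P.a) (hb : ContDiff ℝ 1 P.b)
    (hf : ContDiff ℝ 1 P.f) (hg : ContDiff ℝ 1 P.g) (y v l : ℝ) :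
    deriv (fun y => P.hamiltonian y v l) y =
      deriv P.a y + deriv P.b y * v + l * (deriv P.f y + v * deriv P.g y) := by
  have := (((hasDerivAt_of_contDiff ha y).add ((hasDerivAt_of_contDiff hb y).mul_const v)).add_const
    (P.r * v ^ 2)).add (((hasDerivAt_of_contDiff hf y).add
      ((hasDerivAt_of_contDiff hg y).const_mul v)).const_mul l)
  exact this.deriv

theorem IsAdmissible.intervalIntegrable {x u : ℝ → ℝ} (h : P.IsAdmissible x u) (hT : 0 ≤ P.T) :
    IntervalIntegrable u volume 0 P.T := by
  rw [intervalIntegrable_iff_integrableOn_Icc_of_le hT]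
  exact h.1.integrable (by norm_num)

theorem IsAdmissible.initial {x u : ℝ → ℝ} (h : P.IsAdmissible x u) (hT : 0 ≤ P.T) :
    x 0 = P.x₀ := by
  simpa using h.2.2.2 0 ⟨le_rfl, hT⟩

theorem IsAdmissible.isPrimitiveOn (hf : Continuous P.f) (hg : Continuous P.g) {x u : ℝ → ℝ}
    (h : P.IsAdmissible x u) (hT : 0 ≤ P.T) :
    IsPrimitiveOn x (fun s => P.f (x s) + u s * P.g (x s)) P.T := by
  have hx : ContinuousOn x (uIcc 0 P.T) := by rw [uIcc_of_le hT]; exact h.2.2.1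
  refine ⟨(hf.comp_continuousOn hx).intervalIntegrable.add
    ((h.intervalIntegrable hT).mul_continuousOn (hg.comp_continuousOn hx)), fun t ht => ?_⟩
  rw [h.initial hT]
  exact h.2.2.2 t ht

theorem payoff_eq (hT : 0 ≤ P.T) (x u : ℝ → ℝ) :
    P.payoff x u = P.Ψ (x P.T) +
      ∫ t in Icc 0 P.T, (P.a (x t) + P.b (x t) * u t + P.r * u t ^ 2) := by
  rw [payoff, intervalIntegral.integral_of_le hT, integral_Icc_eq_integral_Ioc]

theorem nonempty_of_isAdmissible (hT : 0 < P.T) {x u : ℝ → ℝ} (h : P.IsAdmissible x u) :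
    P.U.Nonempty := by
  have : (ae (volume.restrict (Icc 0 P.T))).NeBot := by
    rw [ae_neBot, Ne, Measure.restrict_eq_zero, Real.volume_Icc]
    simpa using hT
  obtain ⟨t, ht⟩ := h.2.1.exists
  exact ⟨_, ht⟩

/-- A variational inequality characterising `w` as the nearest point of `U` to `u*` says that `w`
maximises the Hamiltonian. -/
theorem hamiltonian_le_of_projection (hr : P.r < 0) {y l w v : ℝ}
    (h : (P.uStar y l - w) * (v - w) ≤ 0) : P.hamiltonian y v l ≤ P.hamiltonian y w l := by
  have hu : 2 * P.r * P.uStar y l = -P.b y - P.g y * l := by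
    rw [uStar, mul_div_cancel₀ _ (by linarith : 2 * P.r ≠ 0)]
  have key : P.hamiltonian y w l - P.hamiltonian y v l =
      -P.r * ((v - w) ^ 2 - 2 * ((P.uStar y l - w) * (v - w))) := by
    unfold hamiltonian
    linear_combination (w - v) * hu
  have : 0 ≤ -P.r * ((v - w) ^ 2 - 2 * ((P.uStar y l - w) * (v - w))) :=
    mul_nonneg (by linarith) (by nlinarith [sq_nonneg (v - w)])
  linarith

theorem uStar_first_order (hr : P.r < 0) {y l w v : ℝ}
    (h : (P.uStar y l - w) * (v - w) ≤ 0) :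
    (P.b y + P.g y * l + 2 * P.r * w) * (v - w) ≤ 0 := by
  have hu : 2 * P.r * P.uStar y l = -P.b y - P.g y * l := by
    rw [uStar, mul_div_cancel₀ _ (by linarith : 2 * P.r ≠ 0)]
  have key : (P.b y + P.g y * l + 2 * P.r * w) * (v - w) =
      -2 * P.r * ((P.uStar y l - w) * (v - w)) := by
    linear_combination (v - w) * hu
  rw [key]
  exact mul_nonpos_of_nonneg_of_nonpos (by linarith) h

theorem eq_uStar_of_projection {y l w : ℝ}
    (h : ∀ v ∈ P.U, (P.uStar y l - w) * (v - w) ≤ 0) (hmem : P.uStar y l ∈ P.U) :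
    w = P.uStar y l := by
  have := h _ hmem
  have h0 : P.uStar y l - w = 0 := by nlinarith [sq_nonneg (P.uStar y l - w)]
  linarith

/-- The control equation: under the Wronskian condition, `u*` evaluated along a state and costate
pair has derivative `uDot`, wherever the control equals `u*`. -/
theorem hasDerivWithinAt_uStar (hb : ContDiff ℝ 1 P.b) (hg : ContDiff ℝ 1 P.g)
    (hfg : ∀ y, P.g y * deriv P.f y - P.f y * deriv P.g y = 0) {x p : ℝ → ℝ} {v t : ℝ} {S : Set ℝ}
    (hx : HasDerivWithinAt x (P.f (x t) + v * P.g (x t)) S t)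
    (hp : HasDerivWithinAt p (-(deriv P.a (x t) + deriv P.b (x t) * v +
      p t * (deriv P.f (x t) + v * deriv P.g (x t)))) S t) :
    HasDerivWithinAt (fun s => P.uStar (x s) (p s)) (P.uDot (x t)) S t := by
  have h1 := (hasDerivAt_of_contDiff hb (x t)).comp_hasDerivWithinAt t hx
  have h2 := ((hasDerivAt_of_contDiff hg (x t)).comp_hasDerivWithinAt t hx).mul hp
  refine ((h1.neg.sub h2).div_const (2 * P.r)).congr_deriv ?_
  rw [uDot]
  congr 1
  simp only [Function.comp_def]
  linear_combination p t * hfg (x t)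

theorem IsAdmissible.hasDerivWithinAt_state (hf : Continuous P.f) (hg : Continuous P.g)
    {x u w : ℝ → ℝ} (h : P.IsAdmissible x u) (hT : 0 ≤ P.T)
    (hwu : w =ᵐ[volume.restrict (Icc 0 P.T)] u) (hwc : ContinuousOn w (Icc 0 P.T)) {t : ℝ}
    (ht : t ∈ Icc 0 P.T) :
    HasDerivWithinAt x (P.f (x t) + w t * P.g (x t)) (Icc 0 P.T) t := by
  refine ((h.isPrimitiveOn hf hg hT).congr_ae hT
    (ψ := fun s => P.f (x s) + w s * P.g (x s)) ?_).hasDerivWithinAt hT ?_ ht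
  · filter_upwards [hwu] with s hs
    rw [hs]
  · exact (hf.comp_continuousOn h.2.2.1).add (hwc.mul (hg.comp_continuousOn h.2.2.1))

/-- All regularity conclusions follow from the costate equation and the projection property of
the continuous control. -/
theorem conclusions_of_projection (hr : P.r < 0) (hT : 0 < P.T)
    (ha : ContDiff ℝ 1 P.a) (hb : ContDiff ℝ 1 P.b) (hf : ContDiff ℝ 1 P.f) (hg : ContDiff ℝ 1 P.g)
    (hfg : ∀ y, P.g y * deriv P.f y - P.f y * deriv P.g y = 0) {x u w p : ℝ → ℝ}
    (hadm : P.IsAdmissible x u) (hwu : w =ᵐ[volume.restrict (Icc 0 P.T)] u)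
    (hwc : ContinuousOn w (Icc 0 P.T)) (hwU : ∀ t ∈ Icc 0 P.T, w t ∈ P.U)
    (hproj : ∀ t ∈ Icc 0 P.T, ∀ v ∈ P.U, (P.uStar (x t) (p t) - w t) * (v - w t) ≤ 0)
    (hp : P.IsCostate x w p) :
    w =ᵐ[volume.restrict (Icc 0 P.T)] u ∧
      ContinuousOn w (Icc 0 P.T) ∧
      (∀ t ∈ Icc 0 P.T, w t ∈ P.U) ∧
      (∀ t ∈ Icc 0 P.T, HasDerivWithinAt x (P.f (x t) + w t * P.g (x t)) (Icc 0 P.T) t) ∧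
      P.IsCostate x w p ∧
      (∀ t ∈ Icc 0 P.T, ∀ v ∈ P.U,
        P.hamiltonian (x t) v (p t) ≤ P.hamiltonian (x t) (w t) (p t)) ∧
      (∀ t₀ ∈ Icc 0 P.T,
        (∀ᶠ t in 𝓝[Icc 0 P.T] t₀, P.uStar (x t) (p t) ∈ P.U) →
          w t₀ = P.uStar (x t₀) (p t₀) ∧
          HasDerivWithinAt w (P.uDot (x t₀)) (Icc 0 P.T) t₀) ∧
      (P.uTerminal (x P.T) ∈ P.U → w P.T = P.uTerminal (x P.T)) ∧
      ((∀ t ∈ Icc 0 P.T, P.uStar (x t) (p t) ∈ P.U) → P.SolvesBVP x w) := by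
  have hTmem : P.T ∈ Icc 0 P.T := ⟨hT.le, le_rfl⟩
  have hx := fun t ht => hadm.hasDerivWithinAt_state hf.continuous hg.continuous hT.le hwu hwc
    (t := t) ht
  have hloc : ∀ t₀ ∈ Icc 0 P.T, (∀ᶠ t in 𝓝[Icc 0 P.T] t₀, P.uStar (x t) (p t) ∈ P.U) →
      w t₀ = P.uStar (x t₀) (p t₀) ∧ HasDerivWithinAt w (P.uDot (x t₀)) (Icc 0 P.T) t₀ :=
    fun t₀ ht₀ hev => by
      have heq : w t₀ = P.uStar (x t₀) (p t₀) :=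
        eq_uStar_of_projection (hproj t₀ ht₀) (hev.self_of_nhdsWithin ht₀)
      refine ⟨heq, ?_⟩
      have hp' := hp.1 t₀ ht₀
      rw [deriv_hamiltonian ha hb hf hg] at hp'
      refine (hasDerivWithinAt_uStar hb hg hfg (hx t₀ ht₀) hp').congr_of_eventuallyEq ?_ heq
      filter_upwards [hev, self_mem_nhdsWithin] with t ht htm
      exact eq_uStar_of_projection (hproj t htm) ht
  have hterm : P.uStar (x P.T) (p P.T) = P.uTerminal (x P.T) := by
    rw [uStar, uTerminal, hp.2]
  have hterm' : P.uTerminal (x P.T) ∈ P.U → w P.T = P.uTerminal (x P.T) := fun h => by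
    rw [← hterm] at h ⊢
    exact eq_uStar_of_projection (hproj _ hTmem) h
  refine ⟨hwu, hwc, hwU, hx, hp,
    fun t ht v hv => hamiltonian_le_of_projection hr (hproj t ht v hv), hloc, hterm',
    fun hall => ⟨hx, fun t ht => (hloc t ht ?_).2, hadm.initial hT.le, hterm' ?_⟩⟩
  · filter_upwards [self_mem_nhdsWithin] with s hs using hall s hs
  · rw [← hterm]; exact hall _ hTmem

end ControlProblem

theorem ContinuousOn.memLp_restrict_Icc {k : ℝ → ℝ} {T : ℝ} (hk : ContinuousOn k (Icc 0 T)) :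
    MemLp k 2 (volume.restrict (Icc 0 T)) := by
  obtain ⟨C, hC⟩ := isCompact_Icc.exists_bound_of_continuousOn hk
  exact MemLp.of_bound (hk.aestronglyMeasurable measurableSet_Icc) C
    ((ae_restrict_iff' measurableSet_Icc).2 (Eventually.of_forall hC))

namespace ControlProblem

variable {P : ControlProblem}

/-- The maximum principle at an equilibrium of every control. -/
theorem exists_costate_of_common_zero (hr : P.r < 0) (hT : 0 < P.T)
    (ha : ContDiff ℝ 1 P.a) (hb : ContDiff ℝ 1 P.b) (hf : ContDiff ℝ 1 P.f) (hg : ContDiff ℝ 1 P.g)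
    (hUclosed : IsClosed P.U) (hUconvex : Convex ℝ P.U) {x u : ℝ → ℝ} (hopt : P.IsOptimal x u)
    {c : ℝ} (hxc : ∀ t ∈ Icc 0 P.T, x t = c) (hf0 : P.f c = 0) (hg0 : P.g c = 0) :
    ∃ w p : ℝ → ℝ, w =ᵐ[volume.restrict (Icc 0 P.T)] u ∧ ContinuousOn w (Icc 0 P.T) ∧
      (∀ t ∈ Icc 0 P.T, w t ∈ P.U) ∧
      (∀ t ∈ Icc 0 P.T, ∀ v ∈ P.U, (P.uStar (x t) (p t) - w t) * (v - w t) ≤ 0) ∧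
      P.IsCostate x w p := by
  obtain ⟨hadm, hmaxi⟩ := hopt
  have hTmem : P.T ∈ Icc 0 P.T := ⟨hT.le, le_rfl⟩
  obtain ⟨π, -, hπ⟩ := exists_continuous_projection (nonempty_of_isAdmissible hT hadm) hUclosed
    hUconvex
  set ω := π (P.uStar c 0)
  have hstar : ∀ l, P.uStar c l = P.uStar c 0 := fun l => by simp [uStar, hg0]
  set C := deriv P.f c + ω * deriv P.g c
  set D := deriv P.a c + deriv P.b c * ω
  set E : ℝ → ℝ := fun t => ∫ s in P.T..t, Real.exp (-(C * (P.T - s)))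
  have hE : ∀ t, HasDerivAt E (Real.exp (-(C * (P.T - t)))) t := fun t => by
    have : Continuous fun s => Real.exp (-(C * (P.T - s))) := by fun_prop
    exact (this.integral_hasStrictDerivAt P.T t).hasDerivAt
  refine ⟨fun _ => ω, fun t => Real.exp (C * (P.T - t)) * (deriv P.Ψ c - D * E t), ?_,
    continuousOn_const, fun t _ => (hπ _).1, fun t ht v hv => ?_, fun t ht => ?_, ?_⟩
  · have hωadm : P.IsAdmissible x fun _ => ω := by
      refine ⟨memLp_const ω, Eventually.of_forall fun _ => (hπ _).1, hadm.2.2.1, fun t ht => ?_⟩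
      rw [hxc t ht, ← hadm.initial hT.le, hxc 0 ⟨le_rfl, hT.le⟩,
        intervalIntegral.integral_congr (g := fun _ => 0), intervalIntegral.integral_zero, add_zero]
      intro s hs
      rw [uIcc_of_le ht.1] at hs
      simp [hxc s ⟨hs.1, hs.2.trans ht.2⟩, hf0, hg0]
    have hle := hmaxi _ _ hωadm
    rw [payoff_eq hT.le, payoff_eq hT.le, add_le_add_iff_left] at hle
    have hcong : ∀ v : ℝ → ℝ, ∫ t in Icc 0 P.T, (P.a (x t) + P.b (x t) * v t + P.r * v t ^ 2) =
        ∫ t in Icc 0 P.T, (P.a c + P.b c * v t + P.r * v t ^ 2) := fun v =>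
      setIntegral_congr_fun measurableSet_Icc fun t ht => by simp only [hxc t ht]
    rw [hcong, hcong] at hle
    have hint : ∀ v : ℝ → ℝ, MemLp v 2 (volume.restrict (Icc 0 P.T)) →
        Integrable (fun t => P.a c + P.b c * v t + P.r * v t ^ 2) (volume.restrict (Icc 0 P.T)) :=
      fun v hv => ((integrable_const _).add ((hv.integrable (by norm_num)).const_mul _)).add
        (hv.integrable_sq.const_mul _)
    have hdiff : MemLp (fun t => ω - u t) 2 (volume.restrict (Icc 0 P.T)) :=
      (memLp_const ω).sub hadm.1
    refine ae_eq_of_integral_variation_nonpos hr (c := fun _ => P.b c) ?_ hdiff.integrable_sq ?_ ?_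
    · exact ((memLp_const (P.b c)).add (hadm.1.const_mul (2 * P.r))).integrable_mul hdiff
    · filter_upwards [hadm.2.1] with t ht
      have := uStar_first_order hr ((hπ (P.uStar c 0)).2 _ ht)
      simpa [hg0] using this
    · rw [← sub_nonpos, ← integral_sub (hint (fun _ => ω) (memLp_const ω)) (hint u hadm.1)] at hle
      refine le_of_eq_of_le (integral_congr_ae (Eventually.of_forall fun t => ?_)) hle
      simp only
      ring
  · rw [hxc t ht, hstar]
    exact (hπ _).2 v hv
  · rw [deriv_hamiltonian ha hb hf hg, hxc t ht]
    have h1 : HasDerivAt (fun t => Real.exp (C * (P.T - t)))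
        (Real.exp (C * (P.T - t)) * (C * -1)) t :=
      (((hasDerivAt_id t).const_sub P.T).const_mul C).exp
    refine ((h1.mul (((hE t).const_mul D).const_sub (deriv P.Ψ c))).congr_deriv ?_).hasDerivWithinAt
    have h2 : Real.exp (C * (P.T - t)) * Real.exp (-(C * (P.T - t))) = 1 := by
      rw [← Real.exp_add, add_neg_cancel, Real.exp_zero]
    change _ = -(D + _ * C)
    linear_combination -D * h2
  · simp [E, hxc P.T hTmem]

/-- The maximum principle along a path on which `f` and `g` have no common zero. -/
theorem exists_costate_of_no_common_zero (hr : P.r < 0) (hT : 0 < P.T)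
    (ha : ContDiff ℝ 1 P.a) (hb : ContDiff ℝ 1 P.b) (hf : ContDiff ℝ 1 P.f) (hg : ContDiff ℝ 1 P.g)
    (hΨ : Differentiable ℝ P.Ψ) (hUclosed : IsClosed P.U) (hUconvex : Convex ℝ P.U)
    (hfg : ∀ y, P.g y * deriv P.f y - P.f y * deriv P.g y = 0) {x u : ℝ → ℝ}
    (hopt : P.IsOptimal x u) (hne : ∀ t ∈ Icc 0 P.T, P.f (x t) ^ 2 + P.g (x t) ^ 2 ≠ 0) :
    ∃ w p : ℝ → ℝ, w =ᵐ[volume.restrict (Icc 0 P.T)] u ∧ ContinuousOn w (Icc 0 P.T) ∧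
      (∀ t ∈ Icc 0 P.T, w t ∈ P.U) ∧
      (∀ t ∈ Icc 0 P.T, ∀ v ∈ P.U, (P.uStar (x t) (p t) - w t) * (v - w t) ≤ 0) ∧
      P.IsCostate x w p := by
  obtain ⟨hadm, hmaxi⟩ := hopt
  have hT0 := hT.le
  have hTmem : P.T ∈ Icc 0 P.T := ⟨hT0, le_rfl⟩
  have hxc : ContinuousOn x (Icc 0 P.T) := hadm.2.2.1
  have himg := hxc.image_Icc hT0
  set A := sInf (x '' Icc 0 P.T)
  set B := sSup (x '' Icc 0 P.T)
  have hxmem : ∀ t ∈ Icc 0 P.T, x t ∈ Icc A B := fun t ht => himg ▸ mem_image_of_mem x ht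
  have hAB : A ≤ B := (hxmem _ hTmem).1.trans (hxmem _ hTmem).2
  obtain ⟨α, β, δ, M, h, hδ, hhc, hhpos, hhM, hh⟩ := exists_global_common_factor hf hg hfg hAB
    (fun y hy => by
      rw [← himg] at hy
      obtain ⟨t, ht, rfl⟩ := hy
      exact hne t ht)
  have hhx : ∀ t ∈ Icc 0 P.T, P.f (x t) = α * h (x t) ∧ P.g (x t) = β * h (x t) := fun t ht =>
    (hh _ ⟨by linarith [(hxmem t ht).1], by linarith [(hxmem t ht).2]⟩).2
  obtain ⟨G, Φ, hG, hΦ, hΦG⟩ := exists_flow_coordinate hhc hhpos hhM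
  have hΦc : Continuous Φ := continuous_iff_continuousAt.2 fun s => (hΦ s).continuousAt
  have hxp := hadm.isPrimitiveOn hf.continuous hg.continuous hT0
  set θ : ℝ → ℝ := fun t => G (x t)
  have hθ : IsPrimitiveOn θ (fun t => α + β * u t) P.T := by
    refine (hxp.comp hT0 hG (hhc.inv₀ fun y => (hhpos y).ne')).congr hT0 fun t ht => ?_
    have := (hhpos (x t)).ne'
    simp only [(hhx t ht).1, (hhx t ht).2]
    field_simp
  have hxθ : ∀ t, Φ (θ t) = x t := fun t => hΦG (x t)
  have hcx : ∀ {k : ℝ → ℝ}, Continuous k → ContinuousOn (fun t => k (x t)) (Icc 0 P.T) :=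
    fun hk => hk.comp_continuousOn hxc
  have hcx' : ∀ {k : ℝ → ℝ}, Continuous k → ContinuousOn (fun t => k (x t)) (uIcc 0 P.T) :=
    fun hk => by rw [uIcc_of_le hT0]; exact hcx hk
  have ha' := ha.continuous_deriv le_rfl
  have hb' := hb.continuous_deriv le_rfl
  set m : (ℝ → ℝ) → ℝ → ℝ := fun v t => (deriv P.a (x t) + deriv P.b (x t) * v t) * h (x t)
  have hmint : IntervalIntegrable (m u) volume 0 P.T :=
    ((hcx' ha').intervalIntegrable.add
      ((hadm.intervalIntegrable hT0).continuousOn_mul (hcx' hb'))).mul_continuousOn (hcx' hhc)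
  set q : ℝ → ℝ := fun t => (deriv P.Ψ (x P.T) * h (x P.T) + ∫ s in (0 : ℝ)..P.T, m u s)
    + ∫ s in (0 : ℝ)..t, -m u s
  have hq : IsPrimitiveOn q (fun t => -m u t) P.T := IsPrimitiveOn.of_integral hmint.neg _
  have hqT : q P.T = deriv P.Ψ (x P.T) * h (x P.T) := by
    simp only [q, intervalIntegral.integral_neg]; ring
  have hqc := hq.continuousOn hT0
  set p : ℝ → ℝ := fun t => q t / h (x t)
  have hpc : ContinuousOn p (Icc 0 P.T) := hqc.div (hcx hhc) fun t _ => (hhpos _).ne'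
  have hgp : ∀ t ∈ Icc 0 P.T, P.g (x t) * p t = β * q t := fun t ht => by
    have := (hhpos (x t)).ne'
    simp only [(hhx t ht).2, p]
    field_simp
  obtain ⟨π, hπc, hπ⟩ := exists_continuous_projection (nonempty_of_isAdmissible hT hadm) hUclosed
    hUconvex
  set w : ℝ → ℝ := fun t => π (P.uStar (x t) (p t))
  have hwc : ContinuousOn w (Icc 0 P.T) :=
    hπc.comp_continuousOn ((((hcx hb.continuous).neg).sub ((hcx hg.continuous).mul hpc)).div_const _)
  set v : ℝ → ℝ := fun t => w t - u t
  have hv : MemLp v 2 (volume.restrict (Icc 0 P.T)) := hwc.memLp_restrict_Icc.sub hadm.1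
  have hβv : IntervalIntegrable (fun t => β * v t) volume 0 P.T := by
    rw [intervalIntegrable_iff_integrableOn_Icc_of_le hT0]
    exact (hv.integrable (by norm_num)).const_mul β
  set η : ℝ → ℝ := fun t => 0 + ∫ s in (0 : ℝ)..t, β * v s
  have hη : IsPrimitiveOn η (fun t => β * v t) P.T := IsPrimitiveOn.of_integral hβv 0
  have hη0 : η 0 = 0 := by simp [η]
  have hηc := hη.continuousOn hT0
  obtain ⟨N, hN⟩ := isCompact_Icc.exists_bound_of_continuousOn hηc
  have hpull : ∀ {k : ℝ → ℝ}, ContDiff ℝ 1 k →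
      (∀ s, HasDerivAt (fun s => k (Φ s)) (deriv k (Φ s) * h (Φ s)) s) ∧
      Continuous fun s => deriv k (Φ s) * h (Φ s) := fun {k} hk =>
    ⟨fun s => (hasDerivAt_of_contDiff hk (Φ s)).comp s (hΦ s),
      ((hk.continuous_deriv le_rfl).comp hΦc).mul (hhc.comp hΦc)⟩
  set J : ℝ → ℝ := fun ε => P.payoff (fun t => Φ (θ t + ε * η t)) (fun t => u t + ε * v t)
  have hJ0 : J 0 = P.payoff x u := by simp [J, hxθ]
  set D : ℝ := deriv P.Ψ (x P.T) * (h (x P.T) * η P.T) +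
    ∫ t in Icc 0 P.T, (deriv P.a (x t) * h (x t) * η t + (deriv P.b (x t) * h (x t) * η t * u t +
      P.b (x t) * v t) + 2 * P.r * u t * v t)
  have hJ : HasDerivAt J D 0 := by
    have h1 := hasDerivAt_integral_quadratic_payoff (r := P.r) (hpull ha).1 (hpull ha).2
      (hpull hb).1 (hpull hb).2 (hθ.continuousOn hT0) hηc hadm.1 hv
    simp only [hxθ] at h1
    have h2 : HasDerivAt (fun ε : ℝ => θ P.T + ε * η P.T) (η P.T) 0 := by
      simpa using ((hasDerivAt_id (0 : ℝ)).mul_const (η P.T)).const_add (θ P.T)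
    have h3 : HasDerivAt (fun ε : ℝ => Φ (θ P.T + ε * η P.T)) (h (x P.T) * η P.T) 0 := by
      have h4 := hΦ (θ P.T + 0 * η P.T)
      have h5 := h4.comp (0 : ℝ) h2
      simpa [Function.comp_def, hxθ] using h5
    have h6 : HasDerivAt (fun ε : ℝ => P.Ψ (Φ (θ P.T + ε * η P.T)))
        (deriv P.Ψ (x P.T) * (h (x P.T) * η P.T)) 0 := by
      have h7 := (hΨ (Φ (θ P.T + 0 * η P.T))).hasDerivAt.comp (0 : ℝ) h3
      simpa [Function.comp_def, hxθ] using h7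
    refine (h6.add h1).congr_of_eventuallyEq (Eventually.of_forall fun ε => ?_)
    exact payoff_eq hT0 _ _
  have hM0 : 0 < M := (hhpos 0).trans_le (hhM 0)
  have hN0 : 0 ≤ N := (norm_nonneg _).trans (hN _ hTmem)
  have hsmall : ∀ ε, 0 < ε → ε < δ / (M * N + 1) → ∀ t ∈ Icc 0 P.T,
      Φ (θ t + ε * η t) ∈ Icc (A - δ) (B + δ) := fun ε hε hεδ t ht => by
    have h1 := convex_univ.norm_image_sub_le_of_norm_hasDerivWithin_le (C := M)
      (fun s _ => (hΦ s).hasDerivWithinAt)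
      (fun s _ => by rw [Real.norm_eq_abs, abs_of_pos (hhpos _)]; exact hhM _)
      (mem_univ (θ t)) (mem_univ (θ t + ε * η t))
    rw [hxθ, add_sub_cancel_left, norm_mul, Real.norm_eq_abs ε, abs_of_pos hε] at h1
    have h2 : M * (ε * ‖η t‖) ≤ δ := by
      have h3 : ε * (M * N + 1) < δ := (lt_div_iff₀ (by positivity)).1 hεδ
      have h4 : M * (ε * ‖η t‖) ≤ M * (ε * N) := by
        have := hN t ht
        gcongr
      nlinarith
    have h3 := abs_le.1 ((Real.norm_eq_abs _ ▸ h1).trans h2)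
    have h4 := hxmem t ht
    exact ⟨by linarith [h3.1, h4.1], by linarith [h3.2, h4.2]⟩
  have hJle : ∀ᶠ ε in 𝓝[>] (0 : ℝ), J ε ≤ J 0 := by
    filter_upwards [Ioo_mem_nhdsGT (show (0 : ℝ) < min 1 (δ / (M * N + 1)) from
      lt_min one_pos (by positivity))] with ε hε
    rw [hJ0]
    have hε1 : ε < 1 := hε.2.trans_le (min_le_left _ _)
    have hεδ := hsmall ε hε.1 (hε.2.trans_le (min_le_right _ _))
    refine hmaxi _ _ ⟨hadm.1.add (hv.const_mul ε), ?_, ?_, ?_⟩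
    · filter_upwards [hadm.2.1] with t ht
      have := hUconvex ht (hπ (P.uStar (x t) (p t))).1 (sub_nonneg.2 hε1.le) hε.1.le (by ring)
      convert this using 1
      simp only [smul_eq_mul, v, w]
      ring
    · exact hΦc.comp_continuousOn ((hθ.continuousOn hT0).add (hηc.const_smul ε))
    · have hpr := (((hθ.add_const_mul hη hT0 ε).comp hT0 hΦ (hhc.comp hΦc)).congr hT0
        (ψ := fun s => P.f (Φ (θ s + ε * η s)) + (u s + ε * v s) * P.g (Φ (θ s + ε * η s)))
        fun s hs => ?_)
      · intro t ht
        have := hpr.2 t ht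
        beta_reduce at this
        rwa [hη0, mul_zero, add_zero, hxθ, hadm.initial hT0] at this
      · have h1 := (hh _ (hεδ s hs)).2
        simp only
        rw [h1.1, h1.2]
        ring
  have hD := hJ.nonpos_of_eventually_le hJle
  set c : ℝ → ℝ := fun t => P.b (x t) + P.g (x t) * p t
  have hcL : MemLp c 2 (volume.restrict (Icc 0 P.T)) :=
    ((hcx hb.continuous).add ((hcx hg.continuous).mul hpc)).memLp_restrict_Icc
  have hint : Integrable (fun t => (c t + 2 * P.r * u t) * (w t - u t))
      (volume.restrict (Icc 0 P.T)) := (hcL.add (hadm.1.const_mul (2 * P.r))).integrable_mul hv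
  have hDeq : D = ∫ t in Icc 0 P.T, (c t + 2 * P.r * u t) * (w t - u t) := by
    have hparts := hq.mul hη hT0
    have h1 := hparts.2 P.T hTmem
    simp only [hη0, hqT, mul_zero, zero_add] at h1
    rw [intervalIntegral.integral_of_le hT0, ← integral_Icc_eq_integral_Ioc] at h1
    have hi := hparts.1
    rw [intervalIntegrable_iff_integrableOn_Icc_of_le hT0] at hi
    simp only [D]
    rw [← mul_assoc, h1, ← eq_sub_iff_add_eq', ← integral_sub hint hi]
    refine setIntegral_congr_fun measurableSet_Icc fun t ht => ?_
    have := hgp t ht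
    simp only [c, m, v]
    linear_combination (u t - w t) * this
  have hwu : w =ᵐ[volume.restrict (Icc 0 P.T)] u := by
    refine ae_eq_of_integral_variation_nonpos hr hint hv.integrable_sq ?_ ?_
    · filter_upwards [hadm.2.1] with t ht
      exact uStar_first_order hr ((hπ (P.uStar (x t) (p t))).2 _ ht)
    · rw [integral_add hint (hv.integrable_sq.const_mul P.r), integral_const_mul, ← hDeq]
      have : 0 ≤ ∫ t in Icc 0 P.T, (w t - u t) ^ 2 := integral_nonneg fun t => sq_nonneg _
      nlinarith
  refine ⟨w, p, hwu, hwc, fun t _ => (hπ _).1, fun t _ => (hπ _).2, fun t ht => ?_, ?_⟩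
  · have hmc : ContinuousOn (fun t => -m w t) (Icc 0 P.T) :=
      (((hcx ha').add ((hcx hb').mul hwc)).mul (hcx hhc)).neg
    have hqd := (hq.congr_ae hT0 (ψ := fun t => -m w t) (by
      filter_upwards [hwu] with s hs
      simp only [m, hs])).hasDerivWithinAt hT0 hmc ht
    have hxd := hadm.hasDerivWithinAt_state hf.continuous hg.continuous hT0 hwu hwc ht
    have hnear : ∀ᶠ y in 𝓝 (x t), y ∈ Icc (A - δ) (B + δ) :=
      Icc_mem_nhds (by linarith [(hxmem t ht).1]) (by linarith [(hxmem t ht).2])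
    set h' := α * deriv P.f (x t) + β * deriv P.g (x t)
    have hhd : HasDerivAt h h' (x t) :=
      (((hasDerivAt_of_contDiff hf (x t)).const_mul α).add
        ((hasDerivAt_of_contDiff hg (x t)).const_mul β)).congr_of_eventuallyEq
        (hnear.mono fun y hy => (hh y hy).1)
    have hf' : deriv P.f (x t) = α * h' := ((hhd.const_mul α).congr_of_eventuallyEq
      (hnear.mono fun y hy => (hh y hy).2.1)).deriv
    have hg' : deriv P.g (x t) = β * h' := ((hhd.const_mul β).congr_of_eventuallyEq
      (hnear.mono fun y hy => (hh y hy).2.2)).deriv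
    have hpos := (hhpos (x t)).ne'
    refine (hqd.div (hhd.comp_hasDerivWithinAt t hxd) hpos).congr_deriv ?_
    rw [deriv_hamiltonian ha hb hf hg, hf', hg', (hhx t ht).1, (hhx t ht).2]
    simp only [Function.comp_def, m, p]
    clear_value h'
    field_simp
    ring
  · simp only [p, hqT]
    exact mul_div_cancel_right₀ _ (hhpos _).ne'

end ControlProblem

theorem mainTheorem2 (P : ControlProblem) (hr : P.r < 0) (hT : 0 < P.T)
    (ha : ContDiff ℝ 1 P.a) (hb : ContDiff ℝ 1 P.b)
    (hf : ContDiff ℝ 1 P.f) (hg : ContDiff ℝ 1 P.g) (hΨ : Differentiable ℝ P.Ψ)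
    (hUclosed : IsClosed P.U) (hUconvex : Convex ℝ P.U) :
    -- the structural condition and `f = A g`
    ((∃ A : ℝ, ∀ y, P.f y = A * P.g y) →
      ∀ y, P.g y * deriv P.f y - P.f y * deriv P.g y = 0) ∧
    (∀ I : Set ℝ, IsOpen I → IsPreconnected I → (∀ y ∈ I, P.g y ≠ 0) →
      ((∀ y ∈ I, P.g y * deriv P.f y - P.f y * deriv P.g y = 0) ↔
        ∃ A : ℝ, ∀ y ∈ I, P.f y = A * P.g y)) ∧
    -- optimal paths under the structural condition
    ((∀ y, P.g y * deriv P.f y - P.f y * deriv P.g y = 0) →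
      ∀ x u : ℝ → ℝ, P.IsOptimal x u →
        ∃ w p : ℝ → ℝ,
          -- `w` is the continuous version of the optimal control
          w =ᵐ[volume.restrict (Icc 0 P.T)] u ∧
          ContinuousOn w (Icc 0 P.T) ∧
          (∀ t ∈ Icc 0 P.T, w t ∈ P.U) ∧
          (∀ t ∈ Icc 0 P.T,
            HasDerivWithinAt x (P.f (x t) + w t * P.g (x t)) (Icc 0 P.T) t) ∧
          -- `p` is the costate, and `w` maximises the Hamiltonian
          P.IsCostate x w p ∧
          (∀ t ∈ Icc 0 P.T, ∀ v ∈ P.U,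
            P.hamiltonian (x t) v (p t) ≤ P.hamiltonian (x t) (w t) (p t)) ∧
          -- the control equation, wherever the control constraint does not cut off `u*`
          (∀ t₀ ∈ Icc 0 P.T,
            (∀ᶠ t in 𝓝[Icc 0 P.T] t₀, P.uStar (x t) (p t) ∈ P.U) →
              w t₀ = P.uStar (x t₀) (p t₀) ∧
              HasDerivWithinAt w (P.uDot (x t₀)) (Icc 0 P.T) t₀) ∧
          -- the terminal value of the control
          (P.uTerminal (x P.T) ∈ P.U → w P.T = P.uTerminal (x P.T)) ∧
          -- the boundary value problem (unconditional when `U` is the whole line)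
          ((∀ t ∈ Icc 0 P.T, P.uStar (x t) (p t) ∈ P.U) → P.SolvesBVP x w)) := by
  have hfd := hf.differentiable one_ne_zero
  have hgd := hg.differentiable one_ne_zero
  refine ⟨?_, ?_, ?_⟩
  · rintro ⟨A, hA⟩ y
    rw [show P.f = fun y => A * P.g y from funext hA, ((hgd y).hasDerivAt.const_mul A).deriv]
    ring
  · intro I hI hI' hne
    constructor
    · intro hW
      have hd : ∀ y ∈ I, HasDerivAt (fun y => P.f y / P.g y) 0 y := fun y hy => by
        refine ((hfd y).hasDerivAt.div (hgd y).hasDerivAt (hne y hy)).congr_deriv ?_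
        rw [mul_comm (deriv P.f y), hW y hy, zero_div]
      obtain ⟨A, hA⟩ := hI.exists_is_const_of_deriv_eq_zero hI'
        (fun y hy => (hd y hy).differentiableAt.differentiableWithinAt)
        (fun y hy => (hd y hy).deriv)
      exact ⟨A, fun y hy => by rw [← hA y hy, div_mul_cancel₀ _ (hne y hy)]⟩
    · rintro ⟨A, hA⟩ y hy
      have hd : deriv P.f y = A * deriv P.g y :=
        (((hgd y).hasDerivAt.const_mul A).congr_of_eventuallyEq
          (by filter_upwards [hI.mem_nhds hy] with z hz using hA z hz)).deriv
      rw [hd, hA y hy]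
      ring
  · intro hfg x u hopt
    have hex : ∃ w p : ℝ → ℝ, w =ᵐ[volume.restrict (Icc 0 P.T)] u ∧ ContinuousOn w (Icc 0 P.T) ∧
        (∀ t ∈ Icc 0 P.T, w t ∈ P.U) ∧
        (∀ t ∈ Icc 0 P.T, ∀ v ∈ P.U, (P.uStar (x t) (p t) - w t) * (v - w t) ≤ 0) ∧
        P.IsCostate x w p := by
      by_cases hz : ∃ t ∈ Icc 0 P.T, P.f (x t) ^ 2 + P.g (x t) ^ 2 = 0
      · obtain ⟨t₁, ht₁, h0⟩ := hz
        have hf0 : P.f (x t₁) = 0 := by nlinarith [sq_nonneg (P.f (x t₁)), sq_nonneg (P.g (x t₁))]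
        have hg0 : P.g (x t₁) = 0 := by nlinarith [sq_nonneg (P.f (x t₁)), sq_nonneg (P.g (x t₁))]
        exact ControlProblem.exists_costate_of_common_zero hr hT ha hb hf hg hUclosed hUconvex hopt
          (eq_const_of_common_zero hf hg hT.le (hopt.1.intervalIntegrable hT.le)
            (hopt.1.isPrimitiveOn hf.continuous hg.continuous hT.le) ht₁ hf0 hg0) hf0 hg0
      · push Not at hz
        exact ControlProblem.exists_costate_of_no_common_zero hr hT ha hb hf hg hΨ hUclosed hUconvex
          hfg hopt hz
    obtain ⟨w, p, hwu, hwc, hwU, hproj, hp⟩ := hex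
    exact ⟨w, p, ControlProblem.conclusions_of_projection hr hT ha hb hf hg hfg hopt.1 hwu hwc hwU
      hproj hp⟩
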